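/- Let $E$ be an elliptic curve over $\overline{\mathbb{Q}}$ (equivalently, an elliptic curve defined over a number field, considered over $\overline{\mathbb{Q}}$), and let $\mathrm{End}(E)$ be its ring of endomorphisms over $\overline{\mathbb{Q}}$. Let $\hat h$ be the canonical (Néron–Tate) height on $E(\overline{\mathbb{Q}})$, $\hat h(P)=\tfrac12\lim_{k\to\infty}4^{-k}h(x(2^kP))$, where $h$ is the absolute logarithmic Weil height of the $x$-coordinate in a Weierstrass model of $E$ (and $h(x(O))=0$). Let $\|P\|=\sqrt{\hat h(P)}$ be the induced semi-norm, and for $p=(p_1,\dots,p_n)\in E^n(\overline{\mathbb{Q}})$ put $\|p\|=\max_i\|p_i\|$. Let $z_0\in E(\overline{\mathbb{Q}})$ be a non-torsion point, let $n$ be a positive integer, let $\langle z_0\rangle_{\mathrm{End}(E)}=\mathrm{End}(E)\cdot z_0$ be the $\mathrm{End}(E)$-submodule of $E(\overline{\mathbb{Q}})$ generated by $z_0$, and let $G=\langle z_0\rangle_{\mathrm{End}(E)}^{\,n}\subset E^n(\overline{\mathbb{Q}})$. Then for every $N\in\mathbb{N}$ the set $$\{p\in G : \|p\|>N\|z_0\|\}$$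 is Zariski dense in $E^n$. As a consequence, $G$ is Zariski dense in $E^n$. -/

import Mathlib

namespace EllipticPower

open MvPolynomial

universe u

variable {K : Type u} [Field K]

/-- A polynomial over an infinite field that scales like `t ^ n` is homogeneous of degree `n`. -/
lemma isHomogeneous_of_eval_smul {σ : Type*} [Infinite K] {f : MvPolynomial σ K} {n : ℕ}
    (h : ∀ (t : K) (v : σ → K), eval (t • v) f = t ^ n * eval v f) : f.IsHomogeneous n := by
  have hsmul : ∀ (k : ℕ) (t : K) (v : σ → K), eval (t • v) (homogeneousComponent k f) =
      t ^ k * eval v (homogeneousComponent k f) := by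
    intro k t v
    have := (homogeneousComponent_isHomogeneous k f)
    rw [eval_eq, eval_eq, Finset.mul_sum]
    refine Finset.sum_congr rfl fun d hd ↦ ?_
    have hdeg : d.degree = k := by
      by_contra hne
      exact (mem_support_iff.mp hd) (this.coeff_eq_zero hne)
    simp only [Pi.smul_apply, smul_eq_mul, mul_pow, Finset.prod_mul_distrib]
    rw [Finset.prod_pow_eq_pow_sum, ← hdeg, Finsupp.degree_apply]
    ring
  have key : f = homogeneousComponent n f := by
    refine MvPolynomial.funext fun v ↦ ?_
    set m := max n f.totalDegree + 1 with hm
    have hf : f = ∑ k ∈ Finset.range m, homogeneousComponent k f := by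
      conv_lhs => rw [← sum_homogeneousComponent f]
      refine Finset.sum_subset (Finset.range_mono (by omega)) fun k _ hk ↦ ?_
      exact homogeneousComponent_eq_zero _ _ (by simpa using hk)
    have hpoly : (∑ k ∈ Finset.range m, Polynomial.C (eval v (homogeneousComponent k f)) *
        Polynomial.X ^ k) = Polynomial.C (eval v f) * Polynomial.X ^ n := by
      refine Polynomial.funext fun t ↦ ?_
      simp only [Polynomial.eval_finsetSum, Polynomial.eval_mul, Polynomial.eval_C,
        Polynomial.eval_pow, Polynomial.eval_X]
      rw [mul_comm, ← h]
      conv_rhs => rw [hf, map_sum]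
      exact Finset.sum_congr rfl fun k _ ↦ by rw [hsmul, mul_comm]
    have := congrArg (Polynomial.coeff · n) hpoly
    simp only [Polynomial.finsetSum_coeff, Polynomial.coeff_C_mul_X_pow] at this
    rw [Finset.sum_ite_eq, if_pos (by simp [hm])] at this
    simpa using this.symm
  rw [key]
  exact homogeneousComponent_isHomogeneous n f

/-- Homogeneous polynomials scale. -/
lemma eval_smul_of_isHomogeneous {σ : Type*} {f : MvPolynomial σ K} {n : ℕ}
    (h : f.IsHomogeneous n) (t : K) (v : σ → K) : eval (t • v) f = t ^ n * eval v f := by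
  rw [eval_eq, eval_eq, Finset.mul_sum]
  refine Finset.sum_congr rfl fun d hd ↦ ?_
  have hdeg : d.degree = n := by
    by_contra hne
    exact (mem_support_iff.mp hd) (h.coeff_eq_zero hne)
  simp only [Pi.smul_apply, smul_eq_mul, mul_pow, Finset.prod_mul_distrib]
  rw [Finset.prod_pow_eq_pow_sum, ← hdeg, Finsupp.degree_apply]
  ring

variable {W : WeierstrassCurve.Projective K}

/-- Homogeneous coordinates `(X, Y, Z)` of a point of `W` in the projective plane. They are
unique only up to scaling; everything below is independent of the choice. -/
noncomputable def coords (P : W.Point) : Fin 3 → K := Quotient.out P.point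

/-- The value of a triple of polynomials at the homogeneous coordinates of a point. -/
noncomputable def evalAt (F : Fin 3 → MvPolynomial (Fin 3) K) (P : W.Point) : Fin 3 → K :=
  fun j ↦ eval (coords P) (F j)

/-- A map from `W` to itself is regular at `P` if, on the Zariski neighbourhood of `P` where
they do not all vanish, it is given by three homogeneous polynomials of the same degree. -/
def IsRegularAt (φ : W.Point → W.Point) (P : W.Point) : Prop :=
  ∃ (d : ℕ) (F : Fin 3 → MvPolynomial (Fin 3) K), (∀ j, (F j).IsHomogeneous d) ∧
    evalAt F P ≠ 0 ∧ ∀ Q : W.Point, evalAt F Q ≠ 0 → (φ Q).point = ⟦evalAt F Q⟧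

/-- A morphism of varieties from `W` to itself, as a map on points. -/
def IsMorphism (φ : W.Point → W.Point) : Prop := ∀ P, IsRegularAt φ P

lemma mk_coords (P : W.Point) : (⟦coords P⟧ : WeierstrassCurve.Projective.PointClass K) = P.point :=
  Quotient.out_eq _

lemma nonsingular_of_point_eq {P : W.Point} {v : Fin 3 → K} (h : P.point = ⟦v⟧) :
    W.Nonsingular v := by
  have := P.nonsingular
  rwa [h] at this

lemma ne_zero_of_point_eq {P : W.Point} {v : Fin 3 → K} (h : P.point = ⟦v⟧) : v ≠ 0 := by
  rintro rfl
  have := nonsingular_of_point_eq h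
  rw [WeierstrassCurve.Projective.nonsingular_iff] at this
  simp at this

lemma eq_smul_of_mk_eq {v w : Fin 3 → K}
    (h : (⟦v⟧ : WeierstrassCurve.Projective.PointClass K) = ⟦w⟧) : ∃ c : K, c ≠ 0 ∧ v = c • w := by
  obtain ⟨c, hc⟩ := Quotient.exact h
  exact ⟨c, c.ne_zero, hc.symm⟩

lemma mk_smul {v : Fin 3 → K} {c : K} (hc : c ≠ 0) :
    (⟦c • v⟧ : WeierstrassCurve.Projective.PointClass K) = ⟦v⟧ :=
  WeierstrassCurve.Projective.smul_eq v hc.isUnit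

lemma add_point_eq {P Q : W.Point} {v w : Fin 3 → K} (hP : P.point = ⟦v⟧) (hQ : Q.point = ⟦w⟧) :
    (P + Q).point = ⟦W.add v w⟧ := by
  rw [WeierstrassCurve.Projective.Point.add_point, hP, hQ, WeierstrassCurve.Projective.addMap_eq]

lemma add_point_eq_of_ne {P Q : W.Point} {v w : Fin 3 → K} (hP : P.point = ⟦v⟧)
    (hQ : Q.point = ⟦w⟧) (h : P ≠ Q) : (P + Q).point = ⟦W.addXYZ v w⟧ := by
  rw [add_point_eq hP hQ, WeierstrassCurve.Projective.add_of_not_equiv]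
  intro hvw
  exact h (WeierstrassCurve.Projective.Point.ext (by rw [hP, hQ]; exact Quotient.sound hvw))

lemma ne_of_addXYZ_ne_zero {P Q : W.Point} {v w : Fin 3 → K} (hP : P.point = ⟦v⟧)
    (hQ : Q.point = ⟦w⟧) (h : W.addXYZ v w ≠ 0) : P ≠ Q := by
  rintro rfl
  obtain ⟨c, -, rfl⟩ := eq_smul_of_mk_eq (hP.symm.trans hQ)
  refine h ?_
  have := WeierstrassCurve.Projective.addXYZ_smul (W' := W) w w c 1
  rw [one_smul] at this
  rw [this, WeierstrassCurve.Projective.addXYZ_self]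
  ext j
  fin_cases j <;> simp

lemma addXYZ_zero_left (w : Fin 3 → K) : W.addXYZ 0 w = 0 := by
  simpa using WeierstrassCurve.Projective.addXYZ_smul (W' := W) 0 w 0 1

lemma addXYZ_zero_right (v : Fin 3 → K) : W.addXYZ v 0 = 0 := by
  simpa using WeierstrassCurve.Projective.addXYZ_smul (W' := W) v 0 1 0

lemma IsRegularAt.add_of_ne [Infinite K] {φ ψ : W.Point → W.Point} {P : W.Point}
    (hφ : IsRegularAt φ P) (hψ : IsRegularAt ψ P) (h : φ P ≠ ψ P) :
    IsRegularAt (fun Q ↦ φ Q + ψ Q) P := by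
  obtain ⟨d, F, hF, hFP, hFQ⟩ := hφ
  obtain ⟨e, G, hG, hGP, hGQ⟩ := hψ
  have hev : ∀ v : Fin 3 → K,
      (fun j ↦ eval v ((W.map (C : K →+* MvPolynomial (Fin 3) K)).toProjective.addXYZ F G j)) =
        W.addXYZ (fun j ↦ eval v (F j)) (fun j ↦ eval v (G j)) := by
    intro v
    have := WeierstrassCurve.Projective.map_addXYZ
      (W' := (W.map (C : K →+* MvPolynomial (Fin 3) K)).toProjective) (f := eval v) (P := F) (Q := G)
    have hW : (W.map (C : K →+* MvPolynomial (Fin 3) K)).toProjective.map (eval v) = W := by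
      ext <;> simp
    rw [hW] at this
    exact this.symm
  refine ⟨2 * (d + e), (W.map C).toProjective.addXYZ F G, fun j ↦ ?_, ?_, fun Q hQ ↦ ?_⟩
  · refine isHomogeneous_of_eval_smul fun t v ↦ ?_
    have h1 := congrFun (hev (t • v)) j
    have h2 := congrFun (hev v) j
    refine h1.trans (Eq.trans ?_ (congrArg _ h2.symm))
    have e1 : (fun j ↦ eval (t • v) (F j)) = t ^ d • fun j ↦ eval v (F j) := by
      ext j; simp [eval_smul_of_isHomogeneous (hF j)]
    have e2 : (fun j ↦ eval (t • v) (G j)) = t ^ e • fun j ↦ eval v (G j) := by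
      ext j; simp [eval_smul_of_isHomogeneous (hG j)]
    rw [e1, e2, WeierstrassCurve.Projective.addXYZ_smul, Pi.smul_apply, smul_eq_mul]
    ring
  · have := ne_zero_of_point_eq (add_point_eq_of_ne (hFQ P hFP) (hGQ P hGP) h)
    exact fun h0 ↦ this ((hev _).symm.trans h0)
  · have hevQ : evalAt ((W.map C).toProjective.addXYZ F G) Q =
        W.addXYZ (evalAt F Q) (evalAt G Q) := hev _
    rw [hevQ] at hQ ⊢
    have hFQ0 : evalAt F Q ≠ 0 := fun h0 ↦ hQ (by
      rw [h0, addXYZ_zero_left])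
    have hGQ0 : evalAt G Q ≠ 0 := fun h0 ↦ hQ (by
      rw [h0, addXYZ_zero_right])
    exact add_point_eq_of_ne (hFQ Q hFQ0) (hGQ Q hGQ0)
      (ne_of_addXYZ_ne_zero (hFQ Q hFQ0) (hGQ Q hGQ0) hQ)

lemma isMorphism_const (T : W.Point) : IsMorphism (fun _ : W.Point ↦ T) := by
  intro P
  have hev : ∀ Q : W.Point, evalAt (fun j ↦ C (coords T j)) Q = coords T := by
    intro Q; ext j; simp [evalAt]
  refine ⟨0, fun j ↦ C (coords T j), fun j ↦ isHomogeneous_C _ _, ?_, fun Q _ ↦ ?_⟩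
  · rw [hev]; exact ne_zero_of_point_eq (mk_coords T).symm
  · rw [hev, mk_coords]

lemma isMorphism_id : IsMorphism (fun P : W.Point ↦ P) := by
  intro P
  have hev : ∀ Q : W.Point, evalAt X Q = coords Q := by
    intro Q; ext j; simp [evalAt]
  refine ⟨1, X, fun j ↦ isHomogeneous_X _ _, ?_, fun Q _ ↦ ?_⟩
  · rw [hev]; exact ne_zero_of_point_eq (mk_coords P).symm
  · rw [hev, mk_coords]

lemma IsMorphism.neg {φ : W.Point → W.Point} (hφ : IsMorphism φ) :
    IsMorphism (fun Q ↦ -φ Q) := by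
  intro P
  obtain ⟨d, F, hF, hFP, hFQ⟩ := hφ P
  have hev : ∀ Q : W.Point,
      evalAt ![F 0, -F 1 - C W.a₁ * F 0 - C W.a₃ * F 2, F 2] Q = W.neg (evalAt F Q) := by
    intro Q; ext j; fin_cases j <;>
      simp [evalAt, WeierstrassCurve.Projective.neg, WeierstrassCurve.Projective.negY]
  have hpt : ∀ Q : W.Point, evalAt F Q ≠ 0 → (-φ Q).point = ⟦W.neg (evalAt F Q)⟧ := by
    intro Q hQ
    rw [WeierstrassCurve.Projective.Point.neg_point, hFQ Q hQ,
      WeierstrassCurve.Projective.negMap_eq]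
  refine ⟨d, ![F 0, -F 1 - C W.a₁ * F 0 - C W.a₃ * F 2, F 2], fun j ↦ ?_, ?_, fun Q hQ ↦ ?_⟩
  · fin_cases j
    · exact hF 0
    · exact (((hF 1).neg.sub ((hF 0).C_mul _)).sub ((hF 2).C_mul _))
    · exact hF 2
  · rw [hev]; exact ne_zero_of_point_eq (hpt P hFP)
  · rw [hev] at hQ ⊢
    refine hpt Q fun h0 ↦ hQ ?_
    rw [h0]
    ext j; fin_cases j <;>
      simp [WeierstrassCurve.Projective.neg, WeierstrassCurve.Projective.negY]

lemma IsMorphism.comp {φ ψ : W.Point → W.Point} (hφ : IsMorphism φ) (hψ : IsMorphism ψ) :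
    IsMorphism (fun Q ↦ φ (ψ Q)) := by
  intro P
  obtain ⟨e, G, hG, hGP, hGQ⟩ := hψ P
  obtain ⟨d, F, hF, hFP, hFQ⟩ := hφ (ψ P)
  obtain ⟨k, hk⟩ := Function.ne_iff.mp hGP
  have hev : ∀ Q : W.Point, evalAt G Q ≠ 0 → ∃ c : K, c ≠ 0 ∧
      evalAt (fun j ↦ G k * aeval G (F j)) Q = (evalAt G Q k * c) • evalAt F (ψ Q) := by
    intro Q hQ
    obtain ⟨c, hc, hcv⟩ := eq_smul_of_mk_eq ((hGQ Q hQ).symm.trans (mk_coords (ψ Q)).symm)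
    refine ⟨c ^ d, pow_ne_zero _ hc, ?_⟩
    ext j
    have : eval (coords Q) (aeval G (F j)) = eval (evalAt G Q) (F j) := by
      rw [aeval_def, ← coe_eval₂Hom, ← RingHom.comp_apply]
      congr 1
      ext <;> simp [evalAt]
    simp only [evalAt, Pi.smul_apply, smul_eq_mul, map_mul]
    rw [this, hcv, eval_smul_of_isHomogeneous (hF j), mul_assoc]
  refine ⟨e + e * d, fun j ↦ G k * aeval G (F j), fun j ↦ (hG k).mul ((hF j).aeval _ hG), ?_,
    fun Q hQ ↦ ?_⟩
  · obtain ⟨c, hc, h⟩ := hev P hGP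
    rw [h]
    exact smul_ne_zero (mul_ne_zero hk hc) hFP
  · have hGk : evalAt G Q k ≠ 0 := by
      intro h0
      refine hQ (funext fun j ↦ ?_)
      change eval (coords Q) (G k) = 0 at h0
      simp [evalAt, h0]
    obtain ⟨c, hc, h⟩ := hev Q (fun h0 ↦ hGk (congrFun h0 k))
    rw [h] at hQ ⊢
    rw [mk_smul (mul_ne_zero hGk hc)]
    exact hFQ _ fun h0 ↦ hQ (by rw [h0, smul_zero])

/-- An auxiliary point in general position, used to translate away from the diagonal. -/
lemma exists_point [IsAlgClosed K] [CharZero K] [W.IsElliptic] (R : W.Point) :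
    ∃ T : W.Point, T ≠ R ∧ T ≠ -R ∧ T ≠ -T := by
  classical
  let e := WeierstrassCurve.Projective.Point.toAffineAddEquiv W
  suffices h : ∀ R : W.toAffine.Point, ∃ T : W.toAffine.Point, T ≠ R ∧ T ≠ -R ∧ T ≠ -T by
    obtain ⟨T, h1, h2, h3⟩ := h (e R)
    refine ⟨e.symm T, ?_, ?_, ?_⟩
    · rintro rfl; simp at h1
    · intro h; apply h2; rw [← map_neg, ← h]; simp
    · intro h; apply h3
      have := congrArg e h
      simpa using this
  intro R
  obtain ⟨r, hr⟩ : ∃ r : K, ∀ (x y : K) (h : W.toAffine.Nonsingular x y),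
      R = .some x y h → x = r := by
    rcases R with _ | ⟨x, y, h⟩
    · exact ⟨0, fun _ _ _ h ↦ by cases h⟩
    · exact ⟨x, fun _ _ _ h ↦ by cases h; rfl⟩
  let p : Polynomial K := (4 * Polynomial.X ^ 3 + Polynomial.C W.b₂ * Polynomial.X ^ 2 +
    Polynomial.C (2 * W.b₄) * Polynomial.X + Polynomial.C W.b₆)
  have hp : p ≠ 0 := by
    intro h
    have := congrArg (Polynomial.coeff · 3) h
    simp [p] at this
  obtain ⟨x, hx⟩ : ∃ x, (p * (Polynomial.X - Polynomial.C r)).eval x ≠ 0 := by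
    by_contra! hall
    exact mul_ne_zero hp (Polynomial.X_sub_C_ne_zero r)
      (Polynomial.funext fun x ↦ by rw [hall, Polynomial.eval_zero])
  rw [Polynomial.eval_mul] at hx
  have hx1 := left_ne_zero_of_mul hx
  have hx2 : x ≠ r := by
    have := right_ne_zero_of_mul hx
    simpa [sub_eq_zero] using this
  obtain ⟨s, hs⟩ := IsAlgClosed.exists_eq_mul_self (p.eval x)
  have hs0 : s ≠ 0 := by rintro rfl; simp [hs] at hx1
  have hpx : p.eval x = 4 * x ^ 3 + W.b₂ * x ^ 2 + 2 * W.b₄ * x + W.b₆ := by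
    simp [p]
  have hN : W.toAffine.Nonsingular x ((s - W.a₁ * x - W.a₃) / 2) := by
    rw [← WeierstrassCurve.Affine.equation_iff_nonsingular,
      WeierstrassCurve.Affine.equation_iff]
    rw [hpx] at hs
    simp only [WeierstrassCurve.b₂, WeierstrassCurve.b₄, WeierstrassCurve.b₆] at hs
    field_simp
    linear_combination -hs
  refine ⟨.some _ _ hN, ?_, ?_, ?_⟩
  · intro h
    exact hx2 (hr _ _ _ h.symm)
  · intro h
    have h' := neg_eq_iff_eq_neg.mpr h
    rw [WeierstrassCurve.Affine.Point.neg_some] at h'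
    exact hx2 (hr _ _ _ h'.symm)
  · intro h
    rw [WeierstrassCurve.Affine.Point.neg_some] at h
    simp only [WeierstrassCurve.Affine.Point.some.injEq, true_and,
      WeierstrassCurve.Affine.negY] at h
    apply hs0
    field_simp at h
    linear_combination h / 2

lemma IsMorphism.add [IsAlgClosed K] [CharZero K] [W.IsElliptic] {φ ψ : W.Point → W.Point}
    (hφ : IsMorphism φ) (hψ : IsMorphism ψ) : IsMorphism (fun Q ↦ φ Q + ψ Q) := by
  intro P
  by_cases h : φ P = ψ P
  · obtain ⟨T, h1, h2, h3⟩ := exists_point (φ P)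
    have hA : IsRegularAt (fun Q ↦ φ Q + T) P :=
      (hφ P).add_of_ne (isMorphism_const T P) h1.symm
    have hB : IsRegularAt (fun Q ↦ ψ Q + -T) P :=
      (hψ P).add_of_ne (isMorphism_const (-T) P) fun h' ↦ h2 (by rw [h, h', neg_neg])
    have hAB := hA.add_of_ne hB (by
      simp only [h]
      exact fun h' ↦ h3 (add_left_cancel h'))
    have hEq : (fun Q ↦ φ Q + T + (ψ Q + -T)) = fun Q ↦ φ Q + ψ Q := by
      ext1 Q; abel
    rwa [hEq] at hAB
  · exact (hφ P).add_of_ne (hψ P) h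

/-- The endomorphism ring of the elliptic curve `W` over the algebraically closed field `K`:
the group endomorphisms of `W(K)` that are morphisms of varieties. -/
noncomputable def endRing (W : WeierstrassCurve.Projective K) [IsAlgClosed K] [CharZero K]
    [W.IsElliptic] : Subring (AddMonoid.End W.Point) where
  carrier := {φ | IsMorphism φ}
  mul_mem' hφ hψ := hφ.comp hψ
  one_mem' := isMorphism_id
  add_mem' hφ hψ := hφ.add hψ
  zero_mem' := isMorphism_const 0
  neg_mem' hφ := hφ.neg

/-- The Zariski topology on (the `K`-points of) `Wⁿ`, a closed subvariety of `(ℙ²)ⁿ`: a basis of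
open sets is given by the non-vanishing loci of multihomogeneous polynomials in `n` triples of
homogeneous coordinates. -/
@[reducible] noncomputable def zariskiTopology (W : WeierstrassCurve.Projective K) (n : ℕ) :
    TopologicalSpace (Fin n → W.Point) :=
  TopologicalSpace.generateFrom {U | ∃ (d : Fin n → ℕ) (f : MvPolynomial (Fin n × Fin 3) K),
    f.IsWeightedHomogeneous (fun ij : Fin n × Fin 3 ↦ (Pi.single ij.1 1 : Fin n → ℕ)) d ∧
    U = {p | eval (fun ij : Fin n × Fin 3 ↦ coords (p ij.1) ij.2) f ≠ 0}}

/-- A set of points of `Wⁿ` is Zariski dense. -/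
def ZariskiDense {n : ℕ} (S : Set (Fin n → W.Point)) : Prop :=
  @Dense _ (zariskiTopology W n) S

/-- The field `ℚ̄` of algebraic numbers. -/
abbrev Qbar : Type := AlgebraicClosure ℚ

/-- The absolute logarithmic Weil height of the `x`-coordinate of a point
(`0` at the point at infinity). -/
noncomputable def xHeight {W : WeierstrassCurve.Projective Qbar} (P : W.Point) : ℝ :=
  match P.toAffineLift with
  | .zero => 0
  | .some x _ _ => NumberField.absLogHeight₁ x

/-- The canonical (Néron-Tate) height `ĥ(P) = ½ lim 4⁻ᵏ h(x(2ᵏ P))`. -/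
noncomputable def canonicalHeight {W : WeierstrassCurve.Projective Qbar} (P : W.Point) : ℝ :=
  (1 / 2) * Filter.limUnder Filter.atTop fun k : ℕ ↦ xHeight (2 ^ k • P) / 4 ^ k

/-- The semi-norm on `W(ℚ̄)` induced by the canonical height. -/
noncomputable def seminorm {W : WeierstrassCurve.Projective Qbar} (P : W.Point) : ℝ :=
  √(canonicalHeight P)

/-- The semi-norm on `Wⁿ(ℚ̄)`: the maximum of the semi-norms of the coordinates. -/
noncomputable def powSeminorm {W : WeierstrassCurve.Projective Qbar} {n : ℕ}
    (p : Fin n → W.Point) : ℝ :=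
  ⨆ i, seminorm (p i)

/-- The `n`-th power `⟨z₀⟩ⁿ` of the `End(W)`-submodule of `W(ℚ̄)` generated by `z₀`. -/
def cyclicPow {W : WeierstrassCurve.Projective Qbar} [W.IsElliptic] (z₀ : W.Point) (n : ℕ) :
    Set (Fin n → W.Point) :=
  {p | ∀ i, p i ∈ Submodule.span (endRing W) {z₀}}

end EllipticPower

namespace EllipticPower

open NumberField Height

/-- Clearing denominators in the height of an element of a number field. -/
lemma mulHeight₁_mul_absNorm {F : Type*} [Field F] [NumberField F] {y : F} {n : ℕ} (hn : n ≠ 0)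
    {b : 𝓞 F} (h : n * y = b) :
    mulHeight₁ y * (Ideal.span {b, (n : 𝓞 F)}).absNorm =
      ∏ φ : F →+* ℂ, max ‖φ b‖ (n : ℝ) := by
  classical
  have hn' : (n : F) ≠ 0 := mod_cast hn
  have hv (i : Fin 2) : (![b, (n : 𝓞 F)] i : F) = ![(b : F), (n : F)] i := by
    fin_cases i <;> simp
  have hfin := absNorm_mul_finprod_finitePlace_eq_one (K := F) (x := ![b, (n : 𝓞 F)])
    (by simp [hn])
  simp only [hv, Matrix.range_cons, Matrix.range_empty, Set.union_empty,
    Set.singleton_union] at hfin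
  rw [← mul_div_cancel_left₀ y hn', h, mulHeight₁_div_eq_mulHeight,
    NumberField.mulHeight_eq (by simp [hn]),
    mul_assoc, mul_comm (∏ᶠ _, _), hfin, mul_one,
    ← Finset.prod_fiberwise Finset.univ InfinitePlace.mk]
  refine Finset.prod_congr rfl fun w _ ↦ ?_
  rw [← InfinitePlace.card_filter_mk_eq, ← Finset.prod_const]
  refine Finset.prod_congr rfl fun φ hφ ↦ ?_
  rw [← (Finset.mem_filter.mp hφ).2]
  refine le_antisymm (ciSup_le fun i ↦ ?_) (max_le ?_ ?_)
  · fin_cases i <;> simp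
  · exact Finite.le_ciSup_of_le 0 (by simp)
  · exact Finite.le_ciSup_of_le 1 (by simp)

/-- A product over the complex embeddings of `L` that depends only on their restrictions to `K`. -/
lemma prod_embeddings_comp (K L : Type*) [Field K] [NumberField K] [Field L] [NumberField L]
    [Algebra K L] (g : (K →+* ℂ) → ℝ) :
    ∏ ψ : L →+* ℂ, g (ψ.comp (algebraMap K L)) = (∏ φ : K →+* ℂ, g φ) ^ Module.finrank K L := by
  classical
  rw [← Finset.prod_fiberwise Finset.univ (fun ψ : L →+* ℂ ↦ ψ.comp (algebraMap K L)),
    ← Finset.prod_pow]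
  refine Finset.prod_congr rfl fun φ _ ↦ ?_
  have hcard : (Finset.univ.filter fun ψ : L →+* ℂ ↦ ψ.comp (algebraMap K L) = φ).card =
      Module.finrank K L := by
    let := φ.toAlgebra
    rw [← AlgHom.card K L ℂ, ← Fintype.card_subtype]
    refine Fintype.card_congr ⟨fun ψ ↦ ⟨ψ.1, fun x ↦ congrArg (· x) ψ.2⟩,
      fun ψ ↦ ⟨ψ.toRingHom, RingHom.ext ψ.commutes⟩, fun _ ↦ rfl, fun _ ↦ rfl⟩
  rw [← hcard, ← Finset.prod_const]
  exact Finset.prod_congr rfl fun ψ hψ ↦ by rw [(Finset.mem_filter.mp hψ).2]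

/-- The behaviour of the height under an extension of number fields. -/
lemma mulHeight₁_algebraMap {K L : Type*} [Field K] [NumberField K] [Field L] [NumberField L]
    [Algebra K L] (x : K) :
    mulHeight₁ (algebraMap K L x) = mulHeight₁ x ^ Module.finrank K L := by
  obtain ⟨n, hn, a, ha, -⟩ := exists_nat_ne_zero_exists_integer_mul_eq_and_absNorm_span_eq_pow x
  have hK := mulHeight₁_mul_absNorm hn ha
  have hL := mulHeight₁_mul_absNorm (y := algebraMap K L x) (b := algebraMap (𝓞 K) (𝓞 L) a) hn (by
    rw [← map_natCast (algebraMap K L), ← map_mul, ha]; rfl)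
  have hprod : ∏ ψ : L →+* ℂ, max ‖ψ (algebraMap (𝓞 K) (𝓞 L) a : 𝓞 L)‖ (n : ℝ) =
      (∏ φ : K →+* ℂ, max ‖φ a‖ (n : ℝ)) ^ Module.finrank K L :=
    prod_embeddings_comp K L fun φ ↦ max ‖φ a‖ (n : ℝ)
  have hnorm : (Ideal.span {algebraMap (𝓞 K) (𝓞 L) a, (n : 𝓞 L)}).absNorm =
      (Ideal.span {a, (n : 𝓞 K)}).absNorm ^ Module.finrank K L := by
    rw [IsFractionRing.finrank_eq (𝓞 K) K (𝓞 L) L, ← Ideal.absNorm_algebraMap,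
      Ideal.map_span, Set.image_pair, map_natCast]
  have h0 : ((Ideal.span {a, (n : 𝓞 K)}).absNorm : ℝ) ≠ 0 := by
    simp [Ideal.absNorm_eq_zero_iff, hn]
  rw [hprod, hnorm, ← hK, mul_pow, Nat.cast_pow] at hL
  exact mul_right_cancel₀ (pow_ne_zero _ h0) hL

open IntermediateField in
/-- The absolute height can be computed in any number field. -/
lemma absLogHeight₁_coe {F : Type*} [Field F] [CharZero F] (K : IntermediateField ℚ F)
    [NumberField K] (x : K) :
    absLogHeight₁ (x : F) = logHeight₁ x / Module.finrank ℚ K := by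
  have hx : IsIntegral ℚ (x : F) := (IsIntegral.of_finite ℚ x).map K.val
  have : FiniteDimensional ℚ ℚ⟮(x : F)⟯ := adjoin.finiteDimensional hx
  have : NumberField ℚ⟮(x : F)⟯ := {}
  have hle : ℚ⟮(x : F)⟯ ≤ K := by simp
  let := (inclusion hle).toAlgebra
  have : IsScalarTower ℚ ℚ⟮(x : F)⟯ K := IsScalarTower.of_algebraMap_eq fun _ ↦ rfl
  have hmap : algebraMap ℚ⟮(x : F)⟯ K (AdjoinSimple.gen ℚ (x : F)) = x := rfl
  have h := mulHeight₁_algebraMap (L := K) (AdjoinSimple.gen ℚ (x : F))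
  rw [hmap] at h
  have : Module.Free ℚ⟮(x : F)⟯ K := Module.Free.of_divisionRing _ _
  have hrank : (Module.finrank ℚ K : ℝ) =
      Module.finrank ℚ ℚ⟮(x : F)⟯ * Module.finrank ℚ⟮(x : F)⟯ K :=
    mod_cast (Module.finrank_mul_finrank ℚ ℚ⟮(x : F)⟯ K).symm
  have h1 : (Module.finrank ℚ ℚ⟮(x : F)⟯ : ℝ) ≠ 0 := mod_cast Module.finrank_pos.ne'
  have h2 : (Module.finrank ℚ⟮(x : F)⟯ K : ℝ) ≠ 0 := by
    intro h0
    have := hrank.trans (by rw [h0, mul_zero])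
    exact Module.finrank_pos.ne' (mod_cast this : Module.finrank ℚ K = 0)
  rw [absLogHeight₁, absMulHeight₁, dif_pos hx, logHeight₁, h, Real.log_pow,
    Real.log_rpow (mulHeight₁_pos _), hrank]
  field_simp

end EllipticPower

namespace EllipticPower

open WeierstrassCurve NumberField Height

/-- The duplication formula. -/
lemma double_some {K : Type*} [Field K] [DecidableEq K] {W : Affine K} {x y : K}
    (h : W.Nonsingular x y) (h2 : (2 : ℕ) • Affine.Point.some x y h ≠ 0) :
    4 * x ^ 3 + W.b₂ * x ^ 2 + 2 * W.b₄ * x + W.b₆ ≠ 0 ∧ ∃ x' y' h',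
      (2 : ℕ) • Affine.Point.some x y h = .some x' y' h' ∧
      x' * (4 * x ^ 3 + W.b₂ * x ^ 2 + 2 * W.b₄ * x + W.b₆) =
        x ^ 4 - W.b₄ * x ^ 2 - 2 * W.b₆ * x - W.b₈ := by
  have heq := (Affine.equation_iff ..).mp h.1
  rw [two_nsmul] at h2 ⊢
  have hy : y ≠ W.negY x y := fun hy ↦ h2 (Affine.Point.add_self_of_Y_eq hy)
  have hy' : y - W.negY x y ≠ 0 := sub_ne_zero.mpr hy
  have hsq : (y - W.negY x y) ^ 2 = 4 * x ^ 3 + W.b₂ * x ^ 2 + 2 * W.b₄ * x + W.b₆ := by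
    simp only [Affine.negY, b₂, b₄, b₆]
    linear_combination 4 * heq
  refine ⟨hsq ▸ pow_ne_zero 2 hy', _, _, _, Affine.Point.add_self_of_Y_ne hy, ?_⟩
  have hslope : W.slope x x y y * (y - W.negY x y) =
      3 * x ^ 2 + 2 * W.a₂ * x + W.a₄ - W.a₁ * y := by
    rw [Affine.slope_of_Y_ne rfl hy, div_mul_cancel₀ _ hy']
  rw [← hsq, Affine.addX]
  generalize W.slope x x y y = l at hslope
  have h1 : (l ^ 2 + W.a₁ * l - W.a₂ - x - x) * (y - W.negY x y) ^ 2 =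
      (l * (y - W.negY x y)) ^ 2 + W.a₁ * (l * (y - W.negY x y)) * (y - W.negY x y) -
        (W.a₂ + 2 * x) * (y - W.negY x y) ^ 2 := by ring
  rw [h1, hsq, hslope]
  simp only [Affine.negY, b₂, b₄, b₆, b₈]
  linear_combination -W.a₁ ^ 2 * heq

lemma double_some_eq_zero {K : Type*} [Field K] [DecidableEq K] {W : Affine K} {x y : K}
    (h : W.Nonsingular x y) (h2 : (2 : ℕ) • Affine.Point.some x y h = 0) :
    4 * x ^ 3 + W.b₂ * x ^ 2 + 2 * W.b₄ * x + W.b₆ = 0 := by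
  have heq := (Affine.equation_iff ..).mp h.1
  have hy : y = W.negY x y := by
    by_contra hy
    rw [two_nsmul, Affine.Point.add_self_of_Y_ne hy] at h2
    cases h2
  have hy' : y - W.negY x y = 0 := sub_eq_zero.mpr hy
  simp only [Affine.negY] at hy'
  simp only [b₂, b₄, b₆]
  linear_combination (y - (-y - W.a₁ * x - W.a₃)) * hy' - 4 * heq

lemma abs_logHeight_double_le {K : Type*} [Field K] [AdmissibleAbsValues K] (W : WeierstrassCurve K)
    [W.IsElliptic] : ∃ C, ∀ x : K,
      |logHeight ![x ^ 4 - W.b₄ * x ^ 2 - 2 * W.b₆ * x - W.b₈,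
        4 * x ^ 3 + W.b₂ * x ^ 2 + 2 * W.b₄ * x + W.b₆] - 4 * logHeight₁ x| ≤ C := by
  obtain ⟨C₁, h₁⟩ := W.abs_logHeight_addSubMap_sub_two_mul_logHeight_le
  obtain ⟨C₂, h₂⟩ := abs_logHeight_sym2_sub_le (K := K)
  refine ⟨C₁ + 2 * C₂, fun x ↦ ?_⟩
  have h1 := h₁ ![x * x, x * 1 + 1 * x, 1 * 1]
  have h2 := h₂ (a := x) (b := 1) (c := x) (d := 1) (by simp) (by simp)
  have heval : (fun i ↦ (addSubMap W i).eval ![x * x, x * 1 + 1 * x, 1 * 1]) =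
      ![x ^ 4 - W.b₄ * x ^ 2 - 2 * W.b₆ * x - W.b₈,
        4 * x ^ 3 + W.b₂ * x ^ 2 + 2 * W.b₄ * x + W.b₆, 0] := by
    ext i
    fin_cases i <;> simp [addSubMap] <;> ring
  rw [heval, logHeight_cons_cons_cons_zero] at h1
  rw [← logHeight₁_eq_logHeight] at h2
  rw [abs_le] at h1 h2 ⊢
  constructor <;> linarith

/-- The logarithmic height of the `x`-coordinate of an affine point. -/
noncomputable def affineXHeight {F : Type*} [Field F] [CharZero F] {W : Affine F} :
    W.Point → ℝ
  | .zero => 0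
  | .some x _ _ => absLogHeight₁ x

lemma xHeight_eq {W : Projective Qbar} (P : W.Point) :
    xHeight P = affineXHeight P.toAffineLift := by
  rw [xHeight]
  cases P.toAffineLift <;> rfl

/-- The affine points whose `x`-coordinate lies in a subfield. -/
def HasXIn {F : Type*} [Field F] [CharZero F] {W : Affine F}
    (K : IntermediateField ℚ F) (P : W.Point) : Prop :=
  ∀ x y h, P = .some x y h → x ∈ K

/-- Duplication multiplies the height by four, up to a bounded error. -/
lemma abs_affineXHeight_double_le {F : Type*} [Field F] [CharZero F] [DecidableEq F]
    (K : IntermediateField ℚ F) [NumberField K] (V : WeierstrassCurve K) [V.IsElliptic] :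
    ∃ C, ∀ P : (V.map (algebraMap K F)).toAffine.Point, HasXIn K P →
      HasXIn K (2 • P) ∧ |affineXHeight (2 • P) - 4 * affineXHeight P| ≤ C := by
  obtain ⟨C, hC⟩ := abs_logHeight_double_le V
  have hC0 : 0 ≤ C := (abs_nonneg _).trans (hC 0)
  have hd : (0 : ℝ) < Module.finrank ℚ K := mod_cast Module.finrank_pos
  refine ⟨C / Module.finrank ℚ K, fun P hP ↦ ?_⟩
  rcases P with _ | ⟨x, y, h⟩
  · rw [← Affine.Point.zero_def, smul_zero]
    refine ⟨fun _ _ _ h ↦ (by cases h), ?_⟩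
    have : affineXHeight (0 : (V.map (algebraMap K F)).toAffine.Point) = 0 := rfl
    rw [this]
    simpa using div_nonneg hC0 hd.le
  obtain ⟨x, rfl⟩ : ∃ x' : K, (x' : F) = x := ⟨⟨x, hP x y h rfl⟩, rfl⟩
  have hx : affineXHeight (.some (x : F) y h) = logHeight₁ x / Module.finrank ℚ K :=
    absLogHeight₁_coe K x
  have hbound : ∀ t, logHeight ![x ^ 4 - V.b₄ * x ^ 2 - 2 * V.b₆ * x - V.b₈,
      4 * x ^ 3 + V.b₂ * x ^ 2 + 2 * V.b₄ * x + V.b₆] = t →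
      |t / Module.finrank ℚ K - 4 * affineXHeight (.some (x : F) y h)| ≤
        C / Module.finrank ℚ K := by
    rintro _ rfl
    rw [hx, mul_div_assoc', ← sub_div, abs_div, abs_of_pos hd]
    gcongr
    exact hC x
  have h2K : ((2 : K) : F) = 2 := rfl
  have h4K : ((4 : K) : F) = 4 := rfl
  by_cases h2 : 2 • Affine.Point.some (x : F) y h = 0
  · rw [h2]
    refine ⟨fun _ _ _ h ↦ (by cases h), ?_⟩
    have hB : 4 * x ^ 3 + V.b₂ * x ^ 2 + 2 * V.b₄ * x + V.b₆ = 0 := by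
      have := double_some_eq_zero h h2
      apply (algebraMap K F).injective
      simpa [map_b₂, map_b₄, map_b₆, h2K, h4K] using this
    refine (congrArg (|· - _|) ?_).trans_le (hbound 0 ?_)
    · rw [zero_div]; rfl
    · rw [hB]
      simp
  · obtain ⟨hB, x', y', h', heq, hx'⟩ := double_some h h2
    have hB' : 4 * x ^ 3 + V.b₂ * x ^ 2 + 2 * V.b₄ * x + V.b₆ ≠ 0 := by
      rintro h0
      apply hB
      have := congrArg (algebraMap K F) h0
      simpa [map_b₂, map_b₄, map_b₆, h2K, h4K] using this
    have hx'K : x' = ((x ^ 4 - V.b₄ * x ^ 2 - 2 * V.b₆ * x - V.b₈) /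
        (4 * x ^ 3 + V.b₂ * x ^ 2 + 2 * V.b₄ * x + V.b₆) : K) := by
      rw [eq_div_of_mul_eq hB hx']
      simp [map_b₂, map_b₄, map_b₆, map_b₈, h2K, h4K]
    rw [heq]
    refine ⟨fun _ _ _ h ↦ ?_, ?_⟩
    · cases h
      rw [hx'K]
      exact SetLike.coe_mem _
    · have : affineXHeight (.some x' y' h') = logHeight₁ (
        (x ^ 4 - V.b₄ * x ^ 2 - 2 * V.b₆ * x - V.b₈) /
        (4 * x ^ 3 + V.b₂ * x ^ 2 + 2 * V.b₄ * x + V.b₆)) / Module.finrank ℚ K := by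
        rw [← absLogHeight₁_coe K, ← hx'K]
        rfl
      rw [this]
      exact hbound _ (logHeight₁_div_eq_logHeight ..).symm

end EllipticPower

namespace EllipticPower

open WeierstrassCurve Polynomial
open scoped Polynomial.Bivariate

universe u

variable {K : Type u} [Field K]

lemma finite_setOf_X_mem {W : Affine K} {T : Set K} (hT : T.Finite) :
    {P : W.Point | ∀ x y h, P = .some x y h → x ∈ T}.Finite := by
  classical
  have hfib : ∀ v : Fin 2 → K, (Affine.Point.xRep (W' := W) ⁻¹' {v}).Finite := by
    intro v
    rcases (Affine.Point.xRep (W' := W) ⁻¹' {v}).eq_empty_or_nonempty with h | ⟨P, hP⟩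
    · simp [h]
    · refine (Set.toFinite {P, -P}).subset fun Q hQ ↦ ?_
      rw [Set.mem_preimage, Set.mem_singleton_iff] at hP hQ
      exact Affine.Point.eq_or_eq_neg_of_xRep_eq_xRep (hQ.trans hP.symm)
  refine ((hT.image fun x ↦ ![x, 1]).insert ![1, 0] |>.preimage' fun v _ ↦ hfib v).subset ?_
  rintro (_ | ⟨x, y, h⟩) hP
  · exact Or.inl rfl
  · exact Or.inr ⟨x, hP x y h rfl, rfl⟩

section CoordinateRing

variable (W : Affine K)

lemma finite_coordinateRing : Module.Finite K[X] W.CoordinateRing :=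
  .of_basis (Affine.CoordinateRing.basis W)

/-- The degree of the norm, which is the pole order at infinity, is ultrametric. -/
lemma degree_norm_add_le (a b : W.CoordinateRing) :
    (Algebra.norm K[X] (a + b)).degree ≤
      max (Algebra.norm K[X] a).degree (Algebra.norm K[X] b).degree := by
  obtain ⟨p, q, rfl⟩ := Affine.CoordinateRing.exists_smul_basis_eq a
  obtain ⟨r, s, rfl⟩ := Affine.CoordinateRing.exists_smul_basis_eq b
  have : p • (1 : W.CoordinateRing) + q • Affine.CoordinateRing.mk W Y +
      (r • 1 + s • Affine.CoordinateRing.mk W Y) =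
      (p + r) • 1 + (q + s) • Affine.CoordinateRing.mk W Y := by
    simp only [add_smul]; abel
  rw [this]
  simp only [Affine.CoordinateRing.degree_norm_smul_basis]
  have h2 : ∀ p q : K[X], 2 • (p + q).degree ≤ max (2 • p.degree) (2 • q.degree) := by
    intro p q
    have := degree_add_le p q
    rcases le_max_iff.mp this with h | h
    · exact le_max_of_le_left (nsmul_le_nsmul_right h 2)
    · exact le_max_of_le_right (nsmul_le_nsmul_right h 2)
  refine max_le ((h2 p r).trans (max_le_max (le_max_left _ _) (le_max_left _ _))) ?_
  rcases le_max_iff.mp (h2 q s) with h | h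
  · exact (add_le_add_left h 3).trans (le_max_of_le_left (le_max_right _ _))
  · exact (add_le_add_left h 3).trans (le_max_of_le_right (le_max_right _ _))

lemma degree_norm_sum_lt {ι : Type*} (s : Finset ι) (f : ι → W.CoordinateRing) {n : ℕ}
    (h : ∀ i ∈ s, (Algebra.norm K[X] (f i)).degree < n) :
    (Algebra.norm K[X] (∑ i ∈ s, f i)).degree < n := by
  classical
  have := finite_coordinateRing W
  induction s using Finset.induction_on with
  | empty =>
    rw [Finset.sum_empty, Algebra.norm_zero, degree_zero]
    exact WithBot.bot_lt_coe n
  | insert i s hi ih =>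
    rw [Finset.sum_insert hi]
    refine (degree_norm_add_le W _ _).trans_lt (max_lt (h i (by simp)) (ih fun j hj ↦ h j ?_))
    exact Finset.mem_insert_of_mem hj

lemma degree_norm_X :
    (Algebra.norm K[X] (Affine.CoordinateRing.mk W (C X))).degree = 2 := by
  have : Affine.CoordinateRing.mk W (C X) =
      (X : K[X]) • 1 + (0 : K[X]) • Affine.CoordinateRing.mk W Y := by
    simp [Affine.CoordinateRing.smul]
  rw [this, Affine.CoordinateRing.degree_norm_smul_basis]
  simp

lemma degree_norm_Y :
    (Algebra.norm K[X] (Affine.CoordinateRing.mk W Y)).degree = 3 := by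
  have : Affine.CoordinateRing.mk W Y =
      (0 : K[X]) • 1 + (1 : K[X]) • Affine.CoordinateRing.mk W Y := by
    simp
  rw [this, Affine.CoordinateRing.degree_norm_smul_basis]
  simp

lemma degree_norm_C {c : K} (hc : c ≠ 0) :
    (Algebra.norm K[X] (Affine.CoordinateRing.mk W (C (C c)))).degree = 0 := by
  have : Affine.CoordinateRing.mk W (C (C c)) =
      (C c : K[X]) • 1 + (0 : K[X]) • Affine.CoordinateRing.mk W Y := by
    simp [Affine.CoordinateRing.smul]
  rw [this, Affine.CoordinateRing.degree_norm_smul_basis]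
  simp [degree_C hc]

/-- The restriction of a form to the affine part of the curve. -/
noncomputable def dehomogenize (g : MvPolynomial (Fin 3) K) : K[X][Y] :=
  MvPolynomial.eval₂ (C.comp C) ![C X, Y, 1] g

lemma evalEval_dehomogenize (g : MvPolynomial (Fin 3) K) (x y : K) :
    (dehomogenize g).evalEval x y = MvPolynomial.eval ![x, y, 1] g := by
  rw [dehomogenize, ← coe_evalEvalRingHom, MvPolynomial.hom_eval₂]
  rw [MvPolynomial.eval, MvPolynomial.coe_eval₂Hom]
  congr 1
  · ext; simp
  · ext i; fin_cases i <;> simp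

/-- A form not vanishing at infinity does not vanish identically on the affine part. -/
lemma mk_dehomogenize_ne_zero {g : MvPolynomial (Fin 3) K} {d : ℕ} (hg : g.IsHomogeneous d)
    (h : g.coeff (Finsupp.single 1 d) ≠ 0) :
    Affine.CoordinateRing.mk W (dehomogenize g) ≠ 0 := by
  classical
  have hsum : Affine.CoordinateRing.mk W (dehomogenize g) = ∑ m ∈ g.support,
      Affine.CoordinateRing.mk W (C (C (g.coeff m))) *
        (Affine.CoordinateRing.mk W (C X) ^ m 0 * Affine.CoordinateRing.mk W Y ^ m 1) := by
    rw [dehomogenize, MvPolynomial.eval₂_eq', map_sum]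
    refine Finset.sum_congr rfl fun m _ ↦ ?_
    simp [Fin.prod_univ_three]
  have hdeg : ∀ m ∈ g.support, (Algebra.norm K[X] (Affine.CoordinateRing.mk W (C (C (g.coeff m))) *
        (Affine.CoordinateRing.mk W (C X) ^ m 0 * Affine.CoordinateRing.mk W Y ^ m 1))).degree =
        (2 * m 0 + 3 * m 1 : ℕ) := by
    intro m hm
    simp only [map_mul, map_pow, degree_mul, degree_pow,
      degree_norm_C W (MvPolynomial.mem_support_iff.mp hm), degree_norm_X, degree_norm_Y]
    simp [mul_comm]
  intro h0
  have hmem : Finsupp.single 1 d ∈ g.support := MvPolynomial.mem_support_iff.mpr h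
  rw [hsum, ← Finset.add_sum_erase _ _ hmem] at h0
  have h1 := hdeg _ hmem
  rw [eq_neg_of_add_eq_zero_left h0, ← Finset.sum_neg_distrib] at h1
  refine (degree_norm_sum_lt W _ _ (n := 3 * d) fun m hm ↦ ?_).ne (h1.trans (by simp))
  obtain ⟨hne, hm⟩ := Finset.mem_erase.mp hm
  have hn : ∀ a : W.CoordinateRing, Algebra.norm K[X] (-a) = Algebra.norm K[X] a := by
    intro a
    obtain ⟨p, q, rfl⟩ := Affine.CoordinateRing.exists_smul_basis_eq a
    rw [neg_add, ← neg_smul, ← neg_smul, Affine.CoordinateRing.norm_smul_basis,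
      Affine.CoordinateRing.norm_smul_basis]
    ring
  rw [hn, hdeg m hm, Nat.cast_lt]
  have hmd : m 0 + m 1 + m 2 = d := by
    have := hg (MvPolynomial.mem_support_iff.mp hm)
    rw [Finsupp.weight_apply, Finsupp.sum_fintype _ _ (by simp), Fin.sum_univ_three] at this
    simpa using this
  by_contra hlt
  refine hne (Finsupp.ext fun i ↦ ?_)
  fin_cases i <;> simp <;> omega

variable {W}

lemma evalEval_eq_of_mk_eq {F G : K[X][Y]}
    (h : Affine.CoordinateRing.mk W F = Affine.CoordinateRing.mk W G) {x y : K}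
    (hxy : W.Equation x y) : F.evalEval x y = G.evalEval x y := by
  obtain ⟨H, hH⟩ := AdjoinRoot.mk_eq_mk.mp h
  have := congrArg (evalEval x y) hH
  rw [evalEval_sub, evalEval_mul, show W.polynomial.evalEval x y = 0 from hxy, zero_mul] at this
  exact sub_eq_zero.mp this

/-- A function which is not identically zero has finitely many zeros. -/
lemma finite_zeros {G : K[X][Y]} (hG : Affine.CoordinateRing.mk W G ≠ 0) :
    {P : W.Point | ∀ x y h, P = .some x y h → G.evalEval x y = 0}.Finite := by
  classical
  obtain ⟨p, q, hpq⟩ := Affine.CoordinateRing.exists_smul_basis_eq (Affine.CoordinateRing.mk W G)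
  have := finite_coordinateRing W
  have hN : Algebra.norm K[X] (Affine.CoordinateRing.mk W G) ≠ 0 := by
    rwa [Ne, Algebra.norm_eq_zero_iff]
  refine (finite_setOf_X_mem (Algebra.norm K[X]
    (Affine.CoordinateRing.mk W G)).roots.toFinset.finite_toSet).subset fun P hP x y h hPx ↦ ?_
  have hz := hP x y h hPx
  have hnorm := Affine.CoordinateRing.coe_norm_smul_basis (W' := W) p q
  rw [hpq, ← AdjoinRoot.mk_C] at hnorm
  rw [Affine.CoordinateRing.smul, Affine.CoordinateRing.smul, mul_one, ← map_mul,
    ← map_add] at hpq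
  have h1 := evalEval_eq_of_mk_eq hnorm h.1
  have h2 := evalEval_eq_of_mk_eq hpq h.1
  rw [hz] at h2
  rw [evalEval_mul, h2, zero_mul, evalEval_C] at h1
  simpa [hN] using h1

end CoordinateRing

section Projective

variable {W : Projective K}

lemma toAffineLift_eq_toAffine (P : W.Point) :
    P.toAffineLift = Projective.Point.toAffine W (coords P) := by
  rw [Projective.Point.toAffineLift]
  simp only [← mk_coords P]
  rfl

lemma coords_of_toAffineLift_eq_zero {P : W.Point} (h : P.toAffineLift = 0) :
    coords P 0 = 0 ∧ coords P 2 = 0 := by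
  have hP := nonsingular_of_point_eq (mk_coords P).symm
  rw [toAffineLift_eq_toAffine] at h
  by_cases hz : coords P 2 = 0
  · exact ⟨Projective.X_eq_zero_of_Z_eq_zero hP.1 hz, hz⟩
  · rw [Projective.Point.toAffine_of_Z_ne_zero hP hz] at h
    cases h

lemma coords_of_toAffineLift_eq_some {P : W.Point} {x y : K} {h : W.toAffine.Nonsingular x y}
    (hP : P.toAffineLift = .some x y h) :
    coords P 2 ≠ 0 ∧ coords P = coords P 2 • ![x, y, 1] := by
  have hn := nonsingular_of_point_eq (mk_coords P).symm
  rw [toAffineLift_eq_toAffine] at hP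
  by_cases hz : coords P 2 = 0
  · rw [Projective.Point.toAffine_of_Z_eq_zero hz] at hP
    cases hP
  · rw [Projective.Point.toAffine_of_Z_ne_zero hn hz] at hP
    simp only [Affine.Point.some.injEq] at hP
    refine ⟨hz, funext fun j ↦ ?_⟩
    fin_cases j <;> simp [← hP.1, ← hP.2] <;> field_simp

lemma coeff_ne_zero_of_eval_ne_zero {g : MvPolynomial (Fin 3) K} {d : ℕ}
    (hg : g.IsHomogeneous d) {v : Fin 3 → K} (h0 : v 0 = 0) (h2 : v 2 = 0)
    (h : MvPolynomial.eval v g ≠ 0) : g.coeff (Finsupp.single 1 d) ≠ 0 := by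
  contrapose! h
  rw [MvPolynomial.eval_eq']
  refine Finset.sum_eq_zero fun m hm ↦ ?_
  rw [Fin.prod_univ_three, h0, h2]
  by_cases hm0 : m 0 = 0
  · by_cases hm2 : m 2 = 0
    · have hmd := hg (MvPolynomial.mem_support_iff.mp hm)
      rw [Finsupp.weight_apply, Finsupp.sum_fintype _ _ (by simp), Fin.sum_univ_three] at hmd
      have : m = Finsupp.single 1 d := by
        ext i
        fin_cases i <;> simp_all
      rw [this, h, zero_mul]
    · simp [hm2]
  · simp [hm0]

/-- A form not vanishing at some point of the curve has finitely many zeros on the curve. -/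
lemma finite_form_zeros {g : MvPolynomial (Fin 3) K} {d : ℕ} (hg : g.IsHomogeneous d)
    {P : W.Point} (hP : MvPolynomial.eval (coords P) g ≠ 0) :
    {Q : W.Point | MvPolynomial.eval (coords Q) g = 0}.Finite := by
  classical
  have hval : ∀ {Q : W.Point} {x y : K} {h : W.toAffine.Nonsingular x y},
      Q.toAffineLift = .some x y h → ∃ c : K, c ≠ 0 ∧
        MvPolynomial.eval (coords Q) g = c * (dehomogenize g).evalEval x y := by
    intro Q x y h hQ
    obtain ⟨hz, hc⟩ := coords_of_toAffineLift_eq_some hQ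
    refine ⟨coords Q 2 ^ d, pow_ne_zero _ hz, ?_⟩
    rw [hc, eval_smul_of_isHomogeneous hg, evalEval_dehomogenize]
    simp
  have hG : Affine.CoordinateRing.mk W.toAffine (dehomogenize g) ≠ 0 := by
    rcases hPa : P.toAffineLift with _ | ⟨x, y, h⟩
    · obtain ⟨h0, h2⟩ := coords_of_toAffineLift_eq_zero hPa
      exact mk_dehomogenize_ne_zero _ hg (coeff_ne_zero_of_eval_ne_zero hg h0 h2 hP)
    · intro h0
      obtain ⟨c, -, hc⟩ := hval hPa
      rw [evalEval_eq_of_mk_eq (h0.trans (map_zero _).symm) h.1] at hc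
      simp [hP] at hc
  refine ((finite_zeros hG).preimage
    (Projective.Point.toAffineAddEquiv W).injective.injOn).subset fun Q hQ x y h hQx ↦ ?_
  obtain ⟨c, hc, hcv⟩ := hval hQx
  rw [Set.mem_ofPred_eq, hcv] at hQ
  exact (mul_eq_zero.mp hQ).resolve_left hc

section Slot

variable {n : ℕ} (p : Fin n → W.Point) (i : Fin n)

/-- Substitute fixed points into all slots but the `i`-th. -/
noncomputable def restrictSlot (f : MvPolynomial (Fin n × Fin 3) K) : MvPolynomial (Fin 3) K :=
  MvPolynomial.aeval (fun jk : Fin n × Fin 3 ↦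
    if jk.1 = i then MvPolynomial.X jk.2 else MvPolynomial.C (coords (p jk.1) jk.2)) f

lemma eval_restrictSlot (f : MvPolynomial (Fin n × Fin 3) K) (v : Fin 3 → K) :
    MvPolynomial.eval v (restrictSlot p i f) = MvPolynomial.eval
      (fun jk : Fin n × Fin 3 ↦ if jk.1 = i then v jk.2 else coords (p jk.1) jk.2) f := by
  rw [restrictSlot, MvPolynomial.aeval_def, MvPolynomial.eval, MvPolynomial.coe_eval₂Hom,
    ← MvPolynomial.coe_eval₂Hom, MvPolynomial.hom_eval₂]
  congr 1
  · ext; simp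
  · ext jk
    by_cases h : jk.1 = i <;> simp [h]

lemma eval_restrictSlot_coords (f : MvPolynomial (Fin n × Fin 3) K) (t : W.Point) :
    MvPolynomial.eval (coords t) (restrictSlot p i f) = MvPolynomial.eval
      (fun jk : Fin n × Fin 3 ↦ coords (Function.update p i t jk.1) jk.2) f := by
  rw [eval_restrictSlot]
  congr 2
  ext jk
  by_cases h : jk.1 = i
  · simp [h]
  · simp [h]

lemma isHomogeneous_restrictSlot [Infinite K] {f : MvPolynomial (Fin n × Fin 3) K} {d : Fin n → ℕ}
    (hf : f.IsWeightedHomogeneous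
      (fun ij : Fin n × Fin 3 ↦ (Pi.single ij.1 1 : Fin n → ℕ)) d) :
    (restrictSlot p i f).IsHomogeneous (d i) := by
  refine isHomogeneous_of_eval_smul fun t v ↦ ?_
  rw [eval_restrictSlot, eval_restrictSlot, MvPolynomial.eval_eq', MvPolynomial.eval_eq',
    Finset.mul_sum]
  refine Finset.sum_congr rfl fun m hm ↦ ?_
  have hd := congrFun (hf (MvPolynomial.mem_support_iff.mp hm)) i
  rw [Finsupp.weight_apply, Finsupp.sum_fintype _ _ (by simp), Finset.sum_apply] at hd
  rw [mul_left_comm, ← hd, ← Finset.prod_pow_eq_pow_sum, ← Finset.prod_mul_distrib]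
  congr 1
  refine Finset.prod_congr rfl fun jk _ ↦ ?_
  by_cases h : jk.1 = i
  · subst h
    simp [mul_pow]
  · simp [h, Ne.symm h]

end Slot

/-- A product of infinite sets of points is Zariski dense. -/
lemma zariskiDense_of_infinite [Infinite K] {n : ℕ} {S : Set W.Point} (hS : S.Infinite) :
    ZariskiDense {p : Fin n → W.Point | ∀ i, p i ∈ S} := by
  let := zariskiTopology W n
  rw [ZariskiDense, (TopologicalSpace.isTopologicalBasis_of_subbasis
    (t := zariskiTopology W n) rfl).dense_iff]
  rintro _ ⟨F, ⟨hfin, hF⟩, rfl⟩ ⟨p, hp⟩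
  have key : ∀ s : Finset (Fin n), ∃ q ∈ ⋂₀ F, ∀ i ∈ s, q i ∈ S := by
    classical
    intro s
    induction s using Finset.induction_on with
    | empty => exact ⟨p, hp, by simp⟩
    | insert i s hi ih =>
      obtain ⟨q, hq, hqs⟩ := ih
      have hbad : (⋃ U ∈ F, {t : W.Point | Function.update q i t ∉ U}).Finite := by
        refine hfin.biUnion fun U hU ↦ ?_
        obtain ⟨d, f, hf, rfl⟩ := hF hU
        have hqU := hq _ hU
        rw [← Function.update_eq_self i q] at hqU
        simp only [Set.mem_ofPred_eq, ← eval_restrictSlot_coords] at hqU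
        refine (finite_form_zeros (isHomogeneous_restrictSlot q i hf) hqU).subset fun t ht ↦ ?_
        simpa [eval_restrictSlot_coords] using ht
      obtain ⟨t, htS, ht⟩ := (hS.sdiff hbad).nonempty
      refine ⟨Function.update q i t, fun U hU ↦ ?_, fun j hj ↦ ?_⟩
      · by_contra hn
        exact ht (Set.mem_biUnion hU hn)
      · rcases eq_or_ne j i with rfl | hji
        · simpa using htS
        · rw [Function.update_of_ne hji]
          exact hqs j (Finset.mem_of_mem_insert_of_ne hj hji)
  obtain ⟨q, hq, hqS⟩ := key Finset.univ
  exact ⟨q, hq, fun i ↦ hqS i (Finset.mem_univ i)⟩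

end Projective

end EllipticPower

namespace EllipticPower

open WeierstrassCurve NumberField Height Filter Topology

section Northcott

variable {F : Type*} [Field F] [CharZero F]

lemma exists_model (hF : ∀ x : F, IsIntegral ℚ x) (W : WeierstrassCurve F) [W.IsElliptic] (x : F) :
    ∃ (K : IntermediateField ℚ F) (_ : NumberField K) (V : WeierstrassCurve K) (_ : V.IsElliptic),
      V.map (algebraMap K F) = W ∧ x ∈ K := by
  classical
  let S : Finset F := {W.a₁, W.a₂, W.a₃, W.a₄, W.a₆, x}
  let K := IntermediateField.adjoin ℚ (S : Set F)
  have hK : ∀ y ∈ S, y ∈ K := fun y hy ↦ IntermediateField.subset_adjoin ℚ _ hy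
  have : FiniteDimensional ℚ K :=
    IntermediateField.finiteDimensional_adjoin fun y _ ↦ hF y
  let V : WeierstrassCurve K := ⟨⟨W.a₁, hK _ (by simp [S])⟩, ⟨W.a₂, hK _ (by simp [S])⟩,
    ⟨W.a₃, hK _ (by simp [S])⟩, ⟨W.a₄, hK _ (by simp [S])⟩, ⟨W.a₆, hK _ (by simp [S])⟩⟩
  have hV : V.map (algebraMap K F) = W := rfl
  refine ⟨K, {}, V, ⟨?_⟩, hV, hK x (by simp [S])⟩
  have := W.isUnit_Δ
  rw [← hV, map_Δ, isUnit_iff_ne_zero, map_ne_zero] at this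
  exact this.isUnit

lemma finite_setOf_affineXHeight_le (K : IntermediateField ℚ F) [NumberField K] {W : Affine F}
    (B : ℝ) : {P : W.Point | HasXIn K P ∧ affineXHeight P ≤ B}.Finite := by
  have hd : (0 : ℝ) < Module.finrank ℚ K := mod_cast Module.finrank_pos
  refine (finite_setOf_X_mem ((finite_setOfPred_logHeight₁_le K
    (B * Module.finrank ℚ K)).image (algebraMap K F))).subset ?_
  rintro P ⟨hK, hB⟩ x y h rfl
  refine ⟨⟨x, hK x y h rfl⟩, ?_, rfl⟩
  have : affineXHeight (.some x y h) = logHeight₁ (⟨x, hK x y h rfl⟩ : K) / Module.finrank ℚ K :=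
    absLogHeight₁_coe K ⟨x, hK x y h rfl⟩
  rw [this, div_le_iff₀ hd] at hB
  exact hB

/-- A sequence that quadruples up to a bounded error has a limit after rescaling. -/
lemma exists_tendsto_div_four_pow {u : ℕ → ℝ} {C : ℝ} (h : ∀ k, |u (k + 1) - 4 * u k| ≤ C) :
    ∃ L, Tendsto (fun k ↦ u k / 4 ^ k) atTop (𝓝 L) ∧ ∀ k, u k ≤ 4 ^ k * L + C / 3 := by
  have hstep : ∀ k, dist (u k / 4 ^ k) (u (k + 1) / 4 ^ (k + 1)) ≤ C / 4 * (1 / 4) ^ k := by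
    intro k
    have : u k / 4 ^ k - u (k + 1) / 4 ^ (k + 1) = -(u (k + 1) - 4 * u k) / 4 ^ (k + 1) := by
      field_simp
      ring
    rw [Real.dist_eq, this, abs_div, abs_neg, abs_of_pos (by positivity : (0 : ℝ) < 4 ^ (k + 1)),
      div_le_iff₀ (by positivity)]
    refine (h k).trans_eq ?_
    rw [one_div, inv_pow]
    field_simp
    ring
  obtain ⟨L, hL⟩ := cauchySeq_tendsto_of_complete
    (cauchySeq_of_le_geometric (1 / 4) (C / 4) (by norm_num) hstep)
  refine ⟨L, hL, fun k ↦ ?_⟩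
  have := dist_le_of_le_geometric_of_tendsto (1 / 4) (C / 4) (by norm_num) hstep hL k
  rw [Real.dist_eq] at this
  have h2 := (abs_le.mp this).2
  have h4 : (0 : ℝ) < 4 ^ k := by positivity
  have h3 : u k / 4 ^ k ≤ L + C / 3 / 4 ^ k := by
    refine (sub_le_iff_le_add'.mp h2).trans_eq ?_
    rw [one_div, inv_pow]
    field_simp
    ring
  rw [div_le_iff₀ h4] at h3
  refine h3.trans_eq ?_
  field_simp

/-- The limit defining the canonical height exists, and is positive for points of infinite
order. -/
lemma exists_pos_tendsto_affineXHeight [DecidableEq F] (hF : ∀ x : F, IsIntegral ℚ x)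
    (W : WeierstrassCurve F) [W.IsElliptic] {P : W.toAffine.Point} (hP : ¬ IsOfFinAddOrder P) :
    ∃ L, 0 < L ∧ Tendsto (fun k : ℕ ↦ affineXHeight (2 ^ k • P) / 4 ^ k) atTop (𝓝 L) := by
  obtain ⟨x, hx⟩ : ∃ x₀ : F, ∀ x y h, P = .some x y h → x = x₀ := by
    rcases P with _ | ⟨x, y, h⟩
    · exact ⟨0, fun _ _ _ h ↦ by cases h⟩
    · exact ⟨x, fun _ _ _ h ↦ by cases h; rfl⟩
  obtain ⟨K, hK, V, hV, rfl, hxK⟩ := exists_model hF W x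
  obtain ⟨C, hC⟩ := abs_affineXHeight_double_le K V
  have hpow : ∀ k : ℕ, 2 ^ (k + 1) • P = 2 • 2 ^ k • P := fun k ↦ by rw [pow_succ', mul_smul]
  have hX : ∀ k : ℕ, HasXIn K (2 ^ k • P) := by
    intro k
    induction k with
    | zero =>
      rw [pow_zero, one_smul]
      exact fun x y h hPx ↦ hx x y h hPx ▸ hxK
    | succ k ih => rw [hpow]; exact (hC _ ih).1
  obtain ⟨L, hL, hle⟩ := exists_tendsto_div_four_pow (u := fun k ↦ affineXHeight (2 ^ k • P))
    fun k ↦ by simpa only [hpow] using (hC _ (hX k)).2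
  refine ⟨L, ?_, hL⟩
  by_contra! hL0
  have hinj : Function.Injective fun k : ℕ ↦ 2 ^ k • P :=
    (injective_nsmul_iff_not_isOfFinAddOrder.mpr hP).comp (Nat.pow_right_injective le_rfl)
  refine Set.infinite_of_injective_forall_mem hinj (fun k ↦ ?_)
    (finite_setOf_affineXHeight_le K (C / 3))
  refine ⟨hX k, (hle k).trans ?_⟩
  have : (4 : ℝ) ^ k * L ≤ 0 := mul_nonpos_of_nonneg_of_nonpos (by positivity) hL0
  linarith

end Northcott

lemma isIntegral_Qbar (x : Qbar) : IsIntegral ℚ x := by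
  convert (AlgebraicClosure.isAlgebraic ℚ).isIntegral.1 x
  · rfl
  · exact Subsingleton.elim _ _

lemma exists_pos_tendsto_xHeight (W : WeierstrassCurve Qbar) [W.IsElliptic]
    {z : W.toProjective.Point} (hz : ¬ IsOfFinAddOrder z) :
    ∃ L, 0 < L ∧ Tendsto (fun k : ℕ ↦ xHeight (2 ^ k • z) / 4 ^ k) atTop (𝓝 L) := by
  classical
  let e := Projective.Point.toAffineAddEquiv W.toProjective
  obtain ⟨L, hL, h⟩ := exists_pos_tendsto_affineXHeight isIntegral_Qbar W (P := e z)
    (fun h ↦ hz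
      ((Function.Injective.isOfFinAddOrder_iff (f := e.toAddMonoidHom) e.injective).mp h))
  refine ⟨L, hL, h.congr fun k ↦ ?_⟩
  rw [xHeight_eq, ← map_nsmul]
  rfl

lemma seminorm_two_pow_smul (W : WeierstrassCurve Qbar) [W.IsElliptic]
    {z : W.toProjective.Point} (hz : ¬ IsOfFinAddOrder z) :
    0 < seminorm z ∧ ∀ m : ℕ, seminorm (2 ^ m • z) = 2 ^ m * seminorm z := by
  obtain ⟨L, hL, h⟩ := exists_pos_tendsto_xHeight W hz
  have hcan : ∀ m : ℕ, canonicalHeight (2 ^ m • z) = 1 / 2 * (4 ^ m * L) := by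
    intro m
    rw [canonicalHeight]
    congr 1
    refine Tendsto.limUnder_eq ?_
    refine (((tendsto_add_atTop_iff_nat m).mpr h).const_mul (4 ^ m)).congr fun k ↦ ?_
    rw [← mul_smul, ← pow_add, pow_add 4]
    field_simp
  have h0 := hcan 0
  rw [pow_zero, pow_zero, one_smul, one_mul] at h0
  refine ⟨Real.sqrt_pos.mpr (h0 ▸ by positivity), fun m ↦ ?_⟩
  rw [seminorm, seminorm, hcan, h0, mul_left_comm, Real.sqrt_mul (by positivity)]
  congr 1
  rw [show (4 : ℝ) ^ m = (2 ^ m) ^ 2 by rw [← pow_mul, mul_comm, pow_mul]; norm_num]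
  exact Real.sqrt_sq (by positivity)

lemma ZariskiDense.mono {K : Type*} [Field K] {W : Projective K} {n : ℕ}
    {S T : Set (Fin n → W.Point)} (hS : ZariskiDense S) (h : S ⊆ T) : ZariskiDense T :=
  @Dense.mono _ (zariskiTopology W n) _ _ h hS

end EllipticPower

theorem mainTheorem6 (W : WeierstrassCurve (AlgebraicClosure ℚ)) [W.IsElliptic]
    (z₀ : W.toProjective.Point) (hz₀ : ¬ IsOfFinAddOrder z₀) (n : ℕ) (hn : 0 < n) :
    (∀ N : ℕ, EllipticPower.ZariskiDense
      {p | p ∈ EllipticPower.cyclicPow z₀ n ∧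
        (N : ℝ) * EllipticPower.seminorm z₀ < EllipticPower.powSeminorm p}) ∧
    EllipticPower.ZariskiDense (EllipticPower.cyclicPow z₀ n) := by
  obtain ⟨hpos, hpow⟩ := EllipticPower.seminorm_two_pow_smul W hz₀
  have hinj : Function.Injective fun k : ℕ ↦ 2 ^ k • z₀ :=
    (injective_nsmul_iff_not_isOfFinAddOrder.mpr hz₀).comp (Nat.pow_right_injective le_rfl)
  have hdense : ∀ N : ℕ, EllipticPower.ZariskiDense
      {p | p ∈ EllipticPower.cyclicPow z₀ n ∧
        (N : ℝ) * EllipticPower.seminorm z₀ < EllipticPower.powSeminorm p} := by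
    intro N
    refine (EllipticPower.zariskiDense_of_infinite
      ((Set.Ici_infinite N).image hinj.injOn)).mono fun p hp ↦ ⟨fun i ↦ ?_, ?_⟩
    · obtain ⟨m, -, hm⟩ := hp i
      rw [← hm]
      exact nsmul_mem (Submodule.mem_span_singleton_self z₀) _
    · obtain ⟨m, hNm, hm⟩ := hp ⟨0, hn⟩
      refine lt_of_lt_of_le ?_ (le_ciSup (Set.finite_range _).bddAbove ⟨0, hn⟩)
      rw [← hm, hpow]
      refine mul_lt_mul_of_pos_right ?_ hpos
      exact mod_cast (show N ≤ m from hNm).trans_lt Nat.lt_two_pow_self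
  exact ⟨hdense, (hdense 0).mono fun p hp ↦ hp.1⟩
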